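/- Conventions. Let $R$ be an integral domain with quotient field $K$. $R$ is a Prüfer domain if every nonzero finitely generated ideal of $R$ is invertible. For a nonzero fractional ideal $E$ of $R$ put $E^{-1}=(R:_K E)=\{x\in K: xE\subseteq R\}$ and $E_v=(E^{-1})^{-1}$; the map $E\mapsto E_v$ is the $v$-operation. A star operation on $R$ is a map $E\mapsto E^*$ from the nonzero fractional ideals of $R$ to themselves such that $R^*=R$, $(aE)^*=aE^*$ for $0\neq a\in K$, $E\subseteq E^*$, $E\subseteq F\Rightarrow E^*\subseteq F^*$, and $(E^*)^*=E^*$. A star operation $*$ is stable (respectively, finite-stable) if $(A\cap B)^*=A^*\cap B^*$ for all nonzero fractional ideals $A,B$ of $R$ (respectively, for all nonzero finitely generated $R$-submodules $A,B$ of $K$). Theorem. Let $k$ be a field and $X,Y,Z$ indeterminates over $k$. Put $D_1=k(X)[Y]_{(Y)}$, $D_2=k(Y)[X]_{(X)}$, $M_1=YD_1$, $M_2=XD_2$ and $D=D_1\cap D_2$ (inside $k(X,Y)$), $Q_1=M_1\cap D$, $Q_2=M_2\cap D$. Put $V=k(X,Y)[[Z]]$, $M=ZV$, $R=D+M$, $A=Z(D_1+M)$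 and $B=Z(D_2+M)$; the quotient field of $R$ is $k(X,Y)((Z))$. Then: 1. $D_1$ and $D_2$ are valuation domains with quotient field $k(X,Y)$, with unique maximal ideals $M_1$ and $M_2$ respectively, and they are independent, i.e. the only subring of $k(X,Y)$ containing both is $k(X,Y)$. The ring $D$ is a Prüfer domain with exactly two maximal ideals, $Q_1\ne Q_2$, and $(D:D_1)=(D:D_2)=0$, where $(D:D_i)=\{a\in k(X,Y): aD_i\subseteq D\}$. 2. $R$ is a Prüfer domain, and the $v$-operation on $R$ is finite-stable but not stable. 3. More precisely, $A^{-1}=B^{-1}=V$ and $A_v=B_v=M$, while $A\cap B=ZR$ and $(A\cap B)_v=ZR\subsetneq M=A_v\cap B_v$. Consequently each of the following three questions of Anderson and Clarke has a negative answer: (a) If $*$ is a finite-stable star operation on an integral domain, is $*$ stable? (b) If $R$ is an integrally closed domain whose $v$-operation is finite-stable, is the $v$-operation stable? (c) Is the $v$-operation on every Prüfer domain stable? -/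

import Mathlib

open scoped nonZeroDivisors

universe u

/-! Prüfer domains, star operations and stability. -/

/-- A Prüfer domain: an integral domain in which every nonzero finitely generated ideal is
invertible. -/
def IsPruferDomain (R : Type*) [CommRing R] [IsDomain R] : Prop :=
  ∀ I : Ideal R, I.FG → I ≠ ⊥ → IsUnit (I : FractionalIdeal R⁰ (FractionRing R))

section StarOperations

variable {R K : Type*} [CommRing R] [IsDomain R] [Field K] [Algebra R K] [IsFractionRing R K]

/-- `s` is a star operation on the domain `R` with quotient field `K`. Star operations act on
nonzero fractional ideals only: nothing is required of the value of `s` at `0`, and no notion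
below ever looks at it. -/
structure IsStarOperation (s : FractionalIdeal R⁰ K → FractionalIdeal R⁰ K) : Prop where
  map_one : s 1 = 1
  map_smul : ∀ (a : K) (E : FractionalIdeal R⁰ K), a ≠ 0 → E ≠ 0 →
    s (FractionalIdeal.spanSingleton R⁰ a * E) = FractionalIdeal.spanSingleton R⁰ a * s E
  le_map : ∀ E : FractionalIdeal R⁰ K, E ≠ 0 → E ≤ s E
  mono : ∀ E F : FractionalIdeal R⁰ K, E ≠ 0 → F ≠ 0 → E ≤ F → s E ≤ s F
  idem : ∀ E : FractionalIdeal R⁰ K, E ≠ 0 → s (s E) = s E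

/-- `(A ∩ B)^* = A^* ∩ B^*` for all nonzero fractional ideals `A`, `B`. -/
def IsStable (s : FractionalIdeal R⁰ K → FractionalIdeal R⁰ K) : Prop :=
  ∀ A B : FractionalIdeal R⁰ K, A ≠ 0 → B ≠ 0 → s (A ⊓ B) = s A ⊓ s B

/-- `(A ∩ B)^* = A^* ∩ B^*` for all nonzero finitely generated `R`-submodules `A`, `B` of `K`
(these are automatically fractional ideals). -/
def IsFiniteStable (s : FractionalIdeal R⁰ K → FractionalIdeal R⁰ K) : Prop :=
  ∀ A B : FractionalIdeal R⁰ K, A ≠ 0 → B ≠ 0 →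
    (A : Submodule R K).FG → (B : Submodule R K).FG → s (A ⊓ B) = s A ⊓ s B

variable (R K) in
/-- The `v`-operation (divisorial closure) `A ↦ A_v = (A⁻¹)⁻¹`, where `A⁻¹ = (R :_K A)`. -/
noncomputable def vOperation (A : FractionalIdeal R⁰ K) : FractionalIdeal R⁰ K := (A⁻¹)⁻¹

end StarOperations

namespace StarExample

/-! The localization `F[t]_{(t)}` inside a field `L ⊇ F`. -/

section Loc

variable {k L : Type*} [Field k] [Field L] [Algebra k L]

/-- For a subfield `F` of `L` and `t ∈ L` transcendental over `F`, this is the localization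
`F[t]_{(t)}` of the polynomial ring `F[t]` at its prime ideal `(t)`, as a subring of `L`: the
quotients `f(t) / g(t)` with `g ∉ (t)`. (The requirement `g(t) ≠ 0` is then automatic.) -/
noncomputable def locAt (F : IntermediateField k L) (t : L) : Subring L where
  carrier := {z | ∃ f g : Polynomial F, g ∉ Ideal.span {(Polynomial.X : Polynomial F)} ∧
    Polynomial.aeval t g ≠ 0 ∧ z = Polynomial.aeval t f / Polynomial.aeval t g}
  one_mem' := ⟨1, 1, by simp [Ideal.mem_span_singleton, Polynomial.X_dvd_iff], by simp, by simp⟩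
  zero_mem' := ⟨0, 1, by simp [Ideal.mem_span_singleton, Polynomial.X_dvd_iff], by simp, by simp⟩
  mul_mem' := by
    rintro _ _ ⟨f, g, hg, hg0, rfl⟩ ⟨f', g', hg', hg0', rfl⟩
    refine ⟨f * f', g * g', ?_, by simp [hg0, hg0'], by simp [div_mul_div_comm]⟩
    simp_all [Ideal.mem_span_singleton, Polynomial.X_dvd_iff]
  add_mem' := by
    rintro _ _ ⟨f, g, hg, hg0, rfl⟩ ⟨f', g', hg', hg0', rfl⟩
    refine ⟨f * g' + g * f', g * g', ?_, by simp [hg0, hg0'], by simp [div_add_div _ _ hg0 hg0']⟩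
    simp_all [Ideal.mem_span_singleton, Polynomial.X_dvd_iff]
  neg_mem' := by
    rintro _ ⟨f, g, hg, hg0, rfl⟩
    exact ⟨-f, g, hg, hg0, by simp [neg_div]⟩

theorem self_mem_locAt (F : IntermediateField k L) (t : L) : t ∈ locAt F t :=
  ⟨Polynomial.X, 1, by simp [Ideal.mem_span_singleton, Polynomial.X_dvd_iff], by simp, by simp⟩

/-- The principal ideal `t F[t]_{(t)}` of `F[t]_{(t)}`. -/
noncomputable def locIdeal (F : IntermediateField k L) (t : L) : Ideal (locAt F t) :=
  Ideal.span {⟨t, self_mem_locAt F t⟩}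

end Loc

/-! The construction `E + Z L[[Z]]` for a subring `E` of a field `L`. -/

section PlusM

variable {L : Type*} [Field L]

/-- The subring `E + Z L[[Z]]` of `L[[Z]]`. -/
noncomputable def plusM (E : Subring L) : Subring (PowerSeries L) where
  carrier := {f | ∃ d ∈ E, ∃ g : PowerSeries L, f = PowerSeries.C d + PowerSeries.X * g}
  one_mem' := ⟨1, E.one_mem, 0, by simp⟩
  zero_mem' := ⟨0, E.zero_mem, 0, by simp⟩
  mul_mem' := by
    rintro _ _ ⟨d, hd, g, rfl⟩ ⟨d', hd', g', rfl⟩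
    refine ⟨d * d', E.mul_mem hd hd',
      PowerSeries.C d * g' + g * PowerSeries.C d' + PowerSeries.X * (g * g'), ?_⟩
    rw [map_mul]; ring
  add_mem' := by
    rintro _ _ ⟨d, hd, g, rfl⟩ ⟨d', hd', g', rfl⟩
    refine ⟨d + d', E.add_mem hd hd', g + g', ?_⟩
    rw [map_add]; ring
  neg_mem' := by
    rintro _ ⟨d, hd, g, rfl⟩
    refine ⟨-d, E.neg_mem hd, -g, ?_⟩
    rw [map_neg]; ring

theorem X_mul_mem_plusM (E : Subring L) (g : PowerSeries L) : PowerSeries.X * g ∈ plusM E :=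
  ⟨0, E.zero_mem, g, by simp⟩

theorem plusM_mono {E E' : Subring L} (h : E ≤ E') : plusM E ≤ plusM E' := by
  rintro _ ⟨d, hd, g, rfl⟩
  exact ⟨d, h hd, g, rfl⟩

theorem algebraMap_plusM_injective (E : Subring L) :
    Function.Injective (algebraMap (plusM E) (LaurentSeries L)) :=
  (IsFractionRing.injective (PowerSeries L) (LaurentSeries L)).comp Subtype.val_injective

theorem exists_eq_div_plusM (E : Subring L) (z : LaurentSeries L) : ∃ a b : plusM E,
    z = algebraMap (plusM E) (LaurentSeries L) a / algebraMap (plusM E) (LaurentSeries L) b := by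
  obtain ⟨a, b, hb, rfl⟩ := IsFractionRing.div_surjective (A := PowerSeries L) z
  have hX : algebraMap (PowerSeries L) (LaurentSeries L) PowerSeries.X ≠ 0 := by
    rw [Ne, IsFractionRing.to_map_eq_zero_iff]
    exact PowerSeries.X_ne_zero
  refine ⟨⟨_, X_mul_mem_plusM E a⟩, ⟨_, X_mul_mem_plusM E b⟩, ?_⟩
  have h : ∀ c, algebraMap (plusM E) (LaurentSeries L) ⟨_, X_mul_mem_plusM E c⟩ =
      algebraMap (PowerSeries L) (LaurentSeries L) PowerSeries.X *
        algebraMap (PowerSeries L) (LaurentSeries L) c :=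
    fun c => map_mul (algebraMap (PowerSeries L) (LaurentSeries L)) _ _
  rw [h, h, mul_div_mul_left _ _ hX]

/-- The quotient field of `E + Z L[[Z]]` is the field `L((Z))` of Laurent series. -/
instance isFractionRing_plusM (E : Subring L) :
    IsFractionRing (plusM E) (LaurentSeries L) := by
  have : FaithfulSMul (plusM E) (LaurentSeries L) :=
    (faithfulSMul_iff_algebraMap_injective _ _).2 (algebraMap_plusM_injective E)
  exact IsFractionRing.of_field _ _ (exists_eq_div_plusM E)

/-- The ideal `M = Z L[[Z]]` of `E + Z L[[Z]]`. -/
noncomputable def idealM (E : Subring L) : Ideal (plusM E) :=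
  (Ideal.span {(PowerSeries.X : PowerSeries L)}).comap (plusM E).subtype

/-- The element `Z` of `E + Z L[[Z]]`. -/
noncomputable def elemZ (E : Subring L) : plusM E :=
  ⟨PowerSeries.X, by simpa using X_mul_mem_plusM E 1⟩

/-- For subrings `E ≤ E'` of `L`, the ideal `Z (E' + Z L[[Z]])` of `E + Z L[[Z]]`. -/
noncomputable def idealZ {E E' : Subring L} (h : E ≤ E') : Ideal (plusM E) where
  carrier := {r | ∃ f ∈ plusM E', (r : PowerSeries L) = PowerSeries.X * f}
  zero_mem' := ⟨0, zero_mem _, by simp⟩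
  add_mem' := by
    rintro a b ⟨f, hf, ha⟩ ⟨g, hg, hb⟩
    exact ⟨f + g, add_mem hf hg, by rw [Subring.coe_add, ha, hb, mul_add]⟩
  smul_mem' := by
    rintro c a ⟨f, hf, ha⟩
    refine ⟨c * f, mul_mem (plusM_mono h c.2) hf, ?_⟩
    rw [smul_eq_mul, Subring.coe_mul, ha, mul_left_comm]

end PlusM

/-! The rings of the example, over a field `k`. -/

section Rings

variable (k : Type*) [Field k]

/-- The field `k(X, Y)`. -/
abbrev kXY : Type _ := FractionRing (MvPolynomial (Fin 2) k)

/-- The indeterminate `X` in `k(X, Y)`. -/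
noncomputable def x : kXY k := algebraMap (MvPolynomial (Fin 2) k) (kXY k) (MvPolynomial.X 0)

/-- The indeterminate `Y` in `k(X, Y)`. -/
noncomputable def y : kXY k := algebraMap (MvPolynomial (Fin 2) k) (kXY k) (MvPolynomial.X 1)

/-- `D₁ = k(X)[Y]_{(Y)}`. -/
noncomputable def D₁ : Subring (kXY k) := locAt (IntermediateField.adjoin k {x k}) (y k)

/-- `D₂ = k(Y)[X]_{(X)}`. -/
noncomputable def D₂ : Subring (kXY k) := locAt (IntermediateField.adjoin k {y k}) (x k)

/-- `D = D₁ ∩ D₂`. -/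
noncomputable def D : Subring (kXY k) := D₁ k ⊓ D₂ k

theorem D_le_D₁ : D k ≤ D₁ k := inf_le_left

theorem D_le_D₂ : D k ≤ D₂ k := inf_le_right

/-- `M₁ = Y D₁`. -/
noncomputable def M₁ : Ideal (D₁ k) := locIdeal (IntermediateField.adjoin k {x k}) (y k)

/-- `M₂ = X D₂`. -/
noncomputable def M₂ : Ideal (D₂ k) := locIdeal (IntermediateField.adjoin k {y k}) (x k)

/-- `Q₁ = M₁ ∩ D`. -/
noncomputable def Q₁ : Ideal (D k) := (M₁ k).comap (Subring.inclusion (D_le_D₁ k))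

/-- `Q₂ = M₂ ∩ D`. -/
noncomputable def Q₂ : Ideal (D k) := (M₂ k).comap (Subring.inclusion (D_le_D₂ k))

/-- `R = D + M = D + Z k(X, Y)[[Z]]`, with `M = Z k(X, Y)[[Z]]`. -/
noncomputable abbrev R : Subring (PowerSeries (kXY k)) := plusM (D k)

/-- The quotient field `k(X, Y)((Z))` of `R`. -/
abbrev K : Type _ := LaurentSeries (kXY k)

/-- `M = Z k(X, Y)[[Z]]` as a fractional ideal of `R`. -/
noncomputable def M : FractionalIdeal (R k)⁰ (K k) := (idealM (D k) : Ideal (R k))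

/-- `A = Z (D₁ + M)` as a fractional ideal of `R`. -/
noncomputable def A : FractionalIdeal (R k)⁰ (K k) := (idealZ (D_le_D₁ k) : Ideal (R k))

/-- `B = Z (D₂ + M)` as a fractional ideal of `R`. -/
noncomputable def B : FractionalIdeal (R k)⁰ (K k) := (idealZ (D_le_D₂ k) : Ideal (R k))

/-- `Z R` as a fractional ideal of `R`. -/
noncomputable def ZR : FractionalIdeal (R k)⁰ (K k) := (Ideal.span {elemZ (D k)} : Ideal (R k))

/-- `V = k(X, Y)[[Z]]` as a subset of the quotient field of `R`. -/
noncomputable def V : Set (K k) := Set.range (algebraMap (PowerSeries (kXY k)) (K k))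

end Rings

end StarExample

/-!
The rings `D₁` and `D₂` are the valuation rings of the `Y`-adic and the `X`-adic valuation of
`k(X, Y)`: as `k(X, Y) = F(t)` with `t` transcendental over `F` (where `F`, `t` are `k(X)`, `Y` or
`k(Y)`, `X`), every nonzero element is a power of `t` times a unit of `F[t]_{(t)}`
(`StarExample.exists_eq_zpow_mul`). Since `X⁻¹ ∈ D₁` and `Y⁻¹ ∈ D₂`, this gives independence and
`(D : D₁) = (D : D₂) = 0`. The units of `D` are the elements outside `Q₁ ∪ Q₂`, so prime avoidance
identifies the maximal ideals of `D`.

Both `D` and `R` are shown to be Bézout domains, hence Prüfer and integrally closed. In the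
intersection of two valuation rings of a field every fractional ideal `(1, t)` is generated by `1`,
`t` or `1 + t` (`StarExample.exists_generator_inf`). For `R = D + Z k(X, Y)[[Z]]`, divisibility in
the valuation ring `k(X, Y)[[Z]]` reduces a pair of generators to `(1, h)` with `h` a power series,
and a generator of `(1, h(0))` over `D` lifts to one of `(1, h)` (`StarExample.isBezout_plusM`).

Nonzero finitely generated fractional ideals of a Bézout domain are invertible, hence divisorial,
which makes `v` finite-stable: `A_v ∩ B_v = A ∩ B ⊆ (A ∩ B)_v` for such `A`, `B`. On the other hand
a Laurent series `z` with `z D₁ ⊆ R` lies in `Z k(X, Y)[[Z]]`, because its constant coefficient lies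
in `(D : D₁) = 0` (`StarExample.exists_eq_X_mul_of_forall_mul_mem_one`). Applied twice this yields
`A⁻¹ = V` and `A_v = V⁻¹ = M`, and likewise for `B`, whereas `A ∩ B = Z R` is principal and so
divisorial. Thus `v` is not stable, and `R` with its `v`-operation answers all three questions.
-/

namespace StarExample

/-! ### The valuation ring `F[t]_{(t)}` of the field `F(t)` -/

section Loc

variable {k L : Type*} [Field k] [Field L] [Algebra k L] {F : IntermediateField k L} {t : L}

theorem ne_zero_of_transcendental (ht : Transcendental F t) : t ≠ 0 := by
  rintro rfl
  exact ht isAlgebraic_zero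

theorem mem_locAt_of_mem {c : L} (hc : c ∈ F) : c ∈ locAt F t :=
  ⟨Polynomial.C ⟨c, hc⟩, 1, by simp [Ideal.mem_span_singleton, Polynomial.X_dvd_iff], by simp,
    by simp⟩

theorem exists_aeval_eq_pow_mul (ht : Transcendental F t) {f : Polynomial F} (hf : f ≠ 0) :
    ∃ (n : ℕ) (f' : Polynomial F), f' ∉ Ideal.span {(Polynomial.X : Polynomial F)} ∧
      Polynomial.aeval t f' ≠ 0 ∧ Polynomial.aeval t f = t ^ n * Polynomial.aeval t f' := by
  obtain ⟨f', h, hf'⟩ := f.exists_eq_pow_rootMultiplicity_mul_and_not_dvd hf 0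
  rw [Polynomial.C_0, sub_zero] at h hf'
  refine ⟨f.rootMultiplicity 0, f', by rwa [Ideal.mem_span_singleton], fun h0 => ?_, ?_⟩
  · exact hf' ((transcendental_iff.1 ht f' h0).symm ▸ dvd_zero _)
  · conv_lhs => rw [h]
    simp

/-- Every nonzero element of `F(t)` is a power of `t` times a unit of `F[t]_{(t)}`. Here and below
the hypothesis `hL` says that `L = F(t)`. -/
theorem exists_eq_zpow_mul (ht : Transcendental F t)
    (hL : ∀ z : L, ∃ f g : Polynomial F, z = Polynomial.aeval t f / Polynomial.aeval t g)
    {z : L} (hz : z ≠ 0) :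
    ∃ (n : ℤ) (u : L), u ≠ 0 ∧ u ∈ locAt F t ∧ u⁻¹ ∈ locAt F t ∧ z = t ^ n * u := by
  have ht0 : t ≠ 0 := ne_zero_of_transcendental ht
  obtain ⟨f, g, rfl⟩ := hL z
  obtain ⟨m, f', hf', hf0, hf⟩ := exists_aeval_eq_pow_mul ht (f := f) (by rintro rfl; simp at hz)
  obtain ⟨n, g', hg', hg0, hg⟩ := exists_aeval_eq_pow_mul ht (f := g) (by rintro rfl; simp at hz)
  refine ⟨m - n, Polynomial.aeval t f' / Polynomial.aeval t g', div_ne_zero hf0 hg0,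
    ⟨f', g', hg', hg0, rfl⟩, ⟨g', f', hf', hf0, inv_div _ _⟩, ?_⟩
  rw [hf, hg, zpow_sub₀ ht0, zpow_natCast, zpow_natCast, mul_div_mul_comm]

theorem inv_notMem_locAt (ht : Transcendental F t) : t⁻¹ ∉ locAt F t := by
  rintro ⟨f, g, hg, hg0, h⟩
  refine hg (Ideal.mem_span_singleton.2 ⟨f, ?_⟩)
  rw [eq_div_iff hg0, inv_mul_eq_iff_eq_mul₀ (ne_zero_of_transcendental ht)] at h
  refine transcendental_iff_injective.1 ht ?_
  rw [h, map_mul, Polynomial.aeval_X]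

theorem zpow_mem_locAt_iff (ht : Transcendental F t) {n : ℤ} : t ^ n ∈ locAt F t ↔ 0 ≤ n := by
  refine ⟨fun h => ?_, fun h => ?_⟩
  · by_contra! hn
    obtain ⟨m, rfl⟩ : ∃ m : ℕ, n = -1 - m := ⟨(-1 - n).toNat, by omega⟩
    refine inv_notMem_locAt ht ?_
    have := mul_mem h (pow_mem (self_mem_locAt F t) m)
    rwa [← zpow_natCast, ← zpow_add₀ (ne_zero_of_transcendental ht), sub_add_cancel,
      zpow_neg_one] at this
  · lift n to ℕ using h
    rw [zpow_natCast]
    exact pow_mem (self_mem_locAt F t) n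

theorem mem_or_inv_mem_locAt (ht : Transcendental F t)
    (hL : ∀ z : L, ∃ f g : Polynomial F, z = Polynomial.aeval t f / Polynomial.aeval t g)
    (z : L) : z ∈ locAt F t ∨ z⁻¹ ∈ locAt F t := by
  rcases eq_or_ne z 0 with rfl | hz
  · exact Or.inl (zero_mem _)
  obtain ⟨n, u, -, hu, hu', rfl⟩ := exists_eq_zpow_mul ht hL hz
  rcases le_total 0 n with h | h
  · exact Or.inl (mul_mem ((zpow_mem_locAt_iff ht).2 h) hu)
  · rw [mul_inv, ← zpow_neg]
    exact Or.inr (mul_mem ((zpow_mem_locAt_iff ht).2 (by omega)) hu')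

/-- The powers of `t` intersect to zero in `F[t]_{(t)}`. -/
theorem eq_zero_of_forall_mul_inv_pow_mem_locAt (ht : Transcendental F t)
    (hL : ∀ z : L, ∃ f g : Polynomial F, z = Polynomial.aeval t f / Polynomial.aeval t g)
    {a : L} (ha : ∀ n : ℕ, a * t⁻¹ ^ n ∈ locAt F t) : a = 0 := by
  by_contra h0
  obtain ⟨n, u, hu0, -, hu', rfl⟩ := exists_eq_zpow_mul ht hL h0
  -- Dividing by `t` once more than its exponent in `a` leaves a negative power of `t`.
  have h := mul_mem (ha (n.toNat + 1)) hu'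
  have e : t ^ n * u * t⁻¹ ^ (n.toNat + 1) * u⁻¹ = t ^ (n - (n.toNat + 1 : ℕ)) := by
    rw [zpow_sub₀ (ne_zero_of_transcendental ht), zpow_natCast, inv_pow]
    field_simp
  rw [e, zpow_mem_locAt_iff ht] at h
  omega

theorem mem_locIdeal_iff (ht : Transcendental F t) {w : locAt F t} :
    w ∈ locIdeal F t ↔ (w : L) * t⁻¹ ∈ locAt F t := by
  have ht0 := ne_zero_of_transcendental ht
  rw [locIdeal, Ideal.mem_span_singleton]
  constructor
  · rintro ⟨c, rfl⟩
    rw [Subring.coe_mul, mul_comm, inv_mul_cancel_left₀ ht0]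
    exact c.2
  · exact fun h => ⟨⟨_, h⟩, Subtype.ext (by simp [mul_left_comm t, ht0])⟩

/-- An element of `F[t]_{(t)}` is invertible there exactly if it lies outside `(t)`. -/
theorem notMem_locIdeal_iff (ht : Transcendental F t)
    (hL : ∀ z : L, ∃ f g : Polynomial F, z = Polynomial.aeval t f / Polynomial.aeval t g)
    {w : locAt F t} : w ∉ locIdeal F t ↔ (w : L) ≠ 0 ∧ (w : L)⁻¹ ∈ locAt F t := by
  rw [mem_locIdeal_iff ht]
  constructor
  · intro h
    have h0 : (w : L) ≠ 0 := fun h0 => h (by rw [h0, zero_mul]; exact zero_mem _)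
    refine ⟨h0, ?_⟩
    obtain ⟨n, u, -, hu, hu', hw⟩ := exists_eq_zpow_mul ht hL h0
    rw [hw, mul_right_comm, ← zpow_sub_one₀ (ne_zero_of_transcendental ht)] at h
    have hn : n ≤ 0 := by
      by_contra! hn
      exact h (mul_mem ((zpow_mem_locAt_iff ht).2 (by omega)) hu)
    rw [hw, mul_inv, ← zpow_neg]
    exact mul_mem ((zpow_mem_locAt_iff ht).2 (by omega)) hu'
  · rintro ⟨h0, h⟩ h'
    refine inv_notMem_locAt ht ?_
    simpa [h0] using mul_mem h h'

theorem isUnit_subring_iff {L : Type*} [Field L] {S : Subring L} {w : S} :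
    IsUnit w ↔ (w : L) ≠ 0 ∧ (w : L)⁻¹ ∈ S := by
  constructor
  · intro h
    obtain ⟨v, hv⟩ := h.exists_right_inv
    have hv : (w : L) * v = 1 := congrArg Subtype.val hv
    refine ⟨left_ne_zero_of_mul_eq_one hv, ?_⟩
    rw [inv_eq_of_mul_eq_one_right hv]
    exact v.2
  · rintro ⟨h0, h⟩
    exact IsUnit.of_mul_eq_one ⟨_, h⟩ (Subtype.ext (mul_inv_cancel₀ h0))

theorem isFractionRing_of_mem_or_inv_mem {L : Type*} [Field L] {S : Subring L}
    (hS : ∀ z : L, z ∈ S ∨ z⁻¹ ∈ S) : IsFractionRing S L := by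
  refine IsFractionRing.of_field _ _ fun z => ?_
  rcases hS z with h | h
  · exact ⟨⟨z, h⟩, 1, by simp; rfl⟩
  · exact ⟨1, ⟨_, h⟩, by
      rw [map_one, one_div]
      exact (inv_inv z).symm⟩

theorem valuationRing_of_mem_or_inv_mem {L : Type*} [Field L] {S : Subring L}
    (hS : ∀ z : L, z ∈ S ∨ z⁻¹ ∈ S) : ValuationRing S := by
  have := isFractionRing_of_mem_or_inv_mem hS
  refine (ValuationRing.iff_isInteger_or_isInteger S L).2 fun z => ?_
  exact (hS z).imp (fun h => ⟨⟨_, h⟩, rfl⟩) fun h => ⟨⟨_, h⟩, rfl⟩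

theorem setOf_isMaximal_locAt (ht : Transcendental F t)
    (hL : ∀ z : L, ∃ f g : Polynomial F, z = Polynomial.aeval t f / Polynomial.aeval t g) :
    {P : Ideal (locAt F t) | P.IsMaximal} = {locIdeal F t} := by
  have : ValuationRing (locAt F t) :=
    valuationRing_of_mem_or_inv_mem (mem_or_inv_mem_locAt ht hL)
  have h : locIdeal F t = IsLocalRing.maximalIdeal (locAt F t) := by
    ext w
    rw [IsLocalRing.mem_maximalIdeal, mem_nonunits_iff, isUnit_subring_iff,
      ← notMem_locIdeal_iff ht hL, not_not]
  ext P
  rw [h]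
  exact ⟨fun hP => IsLocalRing.eq_maximalIdeal hP,
    fun hP => hP ▸ IsLocalRing.maximalIdeal.isMaximal _⟩

/-- A ring containing `F[t]_{(t)}` and `t⁻¹` is all of `F(t)`. -/
theorem eq_top_of_locAt_le (ht : Transcendental F t)
    (hL : ∀ z : L, ∃ f g : Polynomial F, z = Polynomial.aeval t f / Polynomial.aeval t g)
    {T : Subring L} (hT : locAt F t ≤ T) (htT : t⁻¹ ∈ T) : T = ⊤ := by
  refine eq_top_iff.2 fun z _ => ?_
  rcases eq_or_ne z 0 with rfl | hz
  · exact zero_mem _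
  obtain ⟨n, u, -, hu, -, rfl⟩ := exists_eq_zpow_mul ht hL hz
  refine mul_mem ?_ (hT hu)
  obtain ⟨m, rfl | rfl⟩ := n.eq_nat_or_neg
  · rw [zpow_natCast]
    exact pow_mem (hT (self_mem_locAt F t)) m
  · rw [zpow_neg, zpow_natCast, ← inv_pow]
    exact pow_mem htT m

end Loc

/-! ### The field `k(X, Y)` as a rational function field in one variable -/

section Generators

variable (k : Type*) [Field k]

theorem transcendental_algebraMap_X {i j : Fin 2} (hij : i ≠ j) :
    Transcendental (IntermediateField.adjoin k
      {algebraMap (MvPolynomial (Fin 2) k) (kXY k) (MvPolynomial.X i)})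
      (algebraMap (MvPolynomial (Fin 2) k) (kXY k) (MvPolynomial.X j)) := by
  have h : AlgebraicIndependent k
      (fun i => algebraMap (MvPolynomial (Fin 2) k) (kXY k) (MvPolynomial.X i)) :=
    (MvPolynomial.algebraicIndependent_X (Fin 2) k).map'
      (f := IsScalarTower.toAlgHom k (MvPolynomial (Fin 2) k) (kXY k))
      (IsFractionRing.injective (MvPolynomial (Fin 2) k) (kXY k))
  have := h.transcendental_adjoin (s := {i}) (i := j) (by simpa using hij.symm)
  rwa [Set.image_singleton, ← IntermediateField.transcendental_adjoin_iff] at this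

theorem exists_eq_aeval_div_aeval {F : IntermediateField k (kXY k)} {i j : Fin 2} (hij : i ≠ j)
    (hi : algebraMap (MvPolynomial (Fin 2) k) (kXY k) (MvPolynomial.X i) ∈ F) (z : kXY k) :
    ∃ f g : Polynomial F,
      z = Polynomial.aeval (algebraMap (MvPolynomial (Fin 2) k) (kXY k) (MvPolynomial.X j)) f /
        Polynomial.aeval (algebraMap (MvPolynomial (Fin 2) k) (kXY k) (MvPolynomial.X j)) g := by
  have key : ∀ p : MvPolynomial (Fin 2) k, ∃ f : Polynomial F,
      algebraMap (MvPolynomial (Fin 2) k) (kXY k) p =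
        Polynomial.aeval (algebraMap (MvPolynomial (Fin 2) k) (kXY k) (MvPolynomial.X j)) f := by
    intro p
    induction p using MvPolynomial.induction_on with
    | C a =>
      refine ⟨Polynomial.C (algebraMap k F a), ?_⟩
      rw [Polynomial.aeval_C, ← MvPolynomial.algebraMap_eq, ← IsScalarTower.algebraMap_apply,
        ← IsScalarTower.algebraMap_apply]
    | add p q hp hq =>
      obtain ⟨f, hf⟩ := hp
      obtain ⟨g, hg⟩ := hq
      exact ⟨f + g, by rw [map_add, map_add, hf, hg]⟩
    | mul_X p l hp =>
      obtain ⟨f, hf⟩ := hp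
      obtain rfl | rfl : l = i ∨ l = j := by omega
      · exact ⟨f * Polynomial.C ⟨_, hi⟩, by simp [hf]⟩
      · exact ⟨f * Polynomial.X, by simp [hf]⟩
  obtain ⟨p, q, -, rfl⟩ := IsFractionRing.div_surjective (A := MvPolynomial (Fin 2) k) z
  obtain ⟨f, hf⟩ := key p
  obtain ⟨g, hg⟩ := key q
  exact ⟨f, g, by rw [hf, hg]⟩

theorem transcendental_y : Transcendental (IntermediateField.adjoin k {x k}) (y k) :=
  transcendental_algebraMap_X k (i := 0) (j := 1) (by decide)

theorem transcendental_x : Transcendental (IntermediateField.adjoin k {y k}) (x k) :=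
  transcendental_algebraMap_X k (i := 1) (j := 0) (by decide)

theorem exists_eq_aeval_y_div (z : kXY k) :
    ∃ f g : Polynomial (IntermediateField.adjoin k {x k}),
      z = Polynomial.aeval (y k) f / Polynomial.aeval (y k) g :=
  exists_eq_aeval_div_aeval k (i := 0) (j := 1) (by decide)
    (IntermediateField.mem_adjoin_simple_self k (x k)) z

theorem exists_eq_aeval_x_div (z : kXY k) :
    ∃ f g : Polynomial (IntermediateField.adjoin k {y k}),
      z = Polynomial.aeval (x k) f / Polynomial.aeval (x k) g :=
  exists_eq_aeval_div_aeval k (i := 1) (j := 0) (by decide)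
    (IntermediateField.mem_adjoin_simple_self k (y k)) z

end Generators

/-! ### Bézout subrings of a field, and the construction `E + Z L[[Z]]` -/

section Bezout

variable {L : Type*} [Field L]

/-- If `S` is a valuation ring and `t` lies in its maximal ideal, that is `t⁻¹ ∉ S`, then
`(1 + t)⁻¹ ∈ S`. -/
theorem inv_one_add_mem {S : Subring L} (hS : ∀ z : L, z ∈ S ∨ z⁻¹ ∈ S) {t : L} (ht0 : t ≠ 0)
    (ht : t⁻¹ ∉ S) : 1 + t ≠ 0 ∧ (1 + t)⁻¹ ∈ S := by
  have h0 : 1 + t ≠ 0 := by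
    intro h
    refine ht ?_
    rw [← neg_eq_of_add_eq_zero_right h, inv_neg_one]
    exact neg_mem (one_mem S)
  refine ⟨h0, ?_⟩
  rcases hS (t * (1 + t)⁻¹) with h | h
  · have : (1 + t)⁻¹ = 1 - t * (1 + t)⁻¹ := by field_simp; ring
    rw [this]
    exact sub_mem (one_mem S) h
  · refine absurd ?_ ht
    have : t⁻¹ = (t * (1 + t)⁻¹)⁻¹ - 1 := by field_simp; ring
    rw [this]
    exact sub_mem h (one_mem S)

/-- In the intersection `E` of two valuation rings of a field `L`, every fractional ideal `(1, t)`
is principal, generated by `1`, `t` or `1 + t`. -/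
theorem exists_generator_inf {S₁ S₂ : Subring L} (h₁ : ∀ z : L, z ∈ S₁ ∨ z⁻¹ ∈ S₁)
    (h₂ : ∀ z : L, z ∈ S₂ ∨ z⁻¹ ∈ S₂) (t : L) :
    ∃ p ∈ S₁ ⊓ S₂, ∃ q ∈ S₁ ⊓ S₂, p + q * t ≠ 0 ∧ (p + q * t)⁻¹ ∈ S₁ ⊓ S₂ ∧
      t * (p + q * t)⁻¹ ∈ S₁ ⊓ S₂ := by
  by_cases ht : t ∈ S₁ ⊓ S₂
  · exact ⟨1, one_mem _, 0, zero_mem _, by simp, by simp, by simpa using ht⟩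
  have ht0 : t ≠ 0 := fun h => ht (h ▸ zero_mem _)
  by_cases ht' : t⁻¹ ∈ S₁ ⊓ S₂
  · exact ⟨0, zero_mem _, 1, one_mem _, by simpa, by simpa using ht',
      by simp [ht0]⟩
  -- Neither of `t`, `t⁻¹` lies in both rings, so `t` is a non-unit of one ring and `t⁻¹` of the
  -- other; then `1 + t` generates in both.
  have key : ∀ {S : Subring L}, (∀ z : L, z ∈ S ∨ z⁻¹ ∈ S) → (t⁻¹ ∉ S ∨ t ∉ S) →
      1 + t ≠ 0 ∧ (1 + t)⁻¹ ∈ S ∧ t * (1 + t)⁻¹ ∈ S := by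
    rintro S hS (h | h)
    · obtain ⟨h0, h1⟩ := inv_one_add_mem hS ht0 h
      refine ⟨h0, h1, ?_⟩
      have : t * (1 + t)⁻¹ = 1 - (1 + t)⁻¹ := by field_simp; ring
      rw [this]
      exact sub_mem (one_mem S) h1
    · obtain ⟨h0, h1⟩ := inv_one_add_mem hS (inv_ne_zero ht0) (by rwa [inv_inv])
      have e : 1 + t⁻¹ = (1 + t) * t⁻¹ := by field_simp; ring
      rw [e] at h0 h1
      have h0' : 1 + t ≠ 0 := left_ne_zero_of_mul h0
      rw [mul_inv, inv_inv, mul_comm] at h1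
      refine ⟨h0', ?_, h1⟩
      have : (1 + t)⁻¹ = 1 - t * (1 + t)⁻¹ := by field_simp; ring
      rw [this]
      exact sub_mem (one_mem S) h1
  have hS₁ : t⁻¹ ∉ S₁ ∨ t ∉ S₁ := by
    by_contra! h
    rcases h₂ t with h' | h'
    exacts [ht ⟨h.2, h'⟩, ht' ⟨h.1, h'⟩]
  have hS₂ : t⁻¹ ∉ S₂ ∨ t ∉ S₂ := by
    by_contra! h
    rcases h₁ t with h' | h'
    exacts [ht ⟨h', h.2⟩, ht' ⟨h', h.1⟩]
  obtain ⟨h0, a₁, b₁⟩ := key h₁ hS₁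
  obtain ⟨-, a₂, b₂⟩ := key h₂ hS₂
  exact ⟨1, one_mem _, 1, one_mem _, by simpa using h0, by simpa using ⟨a₁, a₂⟩,
    by simpa using ⟨b₁, b₂⟩⟩

/-- A subring `S` of a commutative ring `V` in which any two elements are comparable for
divisibility is Bézout if for each `t ∈ V` the `S`-module `(1, t)` is generated by a unit of `V`. -/
theorem isBezout_subring {V : Type*} [CommRing V] [PreValuationRing V] {S : Subring V}
    (hS : ∀ t : V, ∃ p ∈ S, ∃ q ∈ S, ∃ w ∈ S, (p + q * t) * w = 1 ∧ t * w ∈ S) : IsBezout S := by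
  have key : ∀ f g : S, (f : V) ∣ g → (Ideal.span {f, g} : Ideal S).IsPrincipal := by
    rintro f g ⟨t, ht⟩
    obtain ⟨p, hp, q, hq, w, hw, hpq, htw⟩ := hS t
    refine ⟨⟨p, hp⟩ * f + ⟨q, hq⟩ * g, le_antisymm ?_ ?_⟩
    · refine Ideal.span_le.2 (Set.pair_subset ?_ ?_)
      · refine Ideal.mem_span_singleton'.2 ⟨⟨w, hw⟩, Subtype.ext ?_⟩
        push_cast
        rw [ht]
        linear_combination (f : V) * hpq
      · refine Ideal.mem_span_singleton'.2 ⟨⟨_, htw⟩, Subtype.ext ?_⟩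
        push_cast
        rw [ht]
        linear_combination (f : V) * t * hpq
    · refine (Ideal.span_singleton_le_iff_mem _).2 ?_
      exact add_mem (Ideal.mul_mem_left _ _ (Ideal.subset_span (by simp)))
        (Ideal.mul_mem_left _ _ (Ideal.subset_span (by simp)))
  refine IsBezout.iff_span_pair_isPrincipal.2 fun f g => ?_
  rcases ValuationRing.dvd_total (f : V) (g : V) with h | h
  · exact key f g h
  · rw [Set.pair_comm]
    exact key g f h

theorem isBezout_of_exists_generator {E : Subring L}
    (hE : ∀ t : L, ∃ p ∈ E, ∃ q ∈ E, p + q * t ≠ 0 ∧ (p + q * t)⁻¹ ∈ E ∧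
      t * (p + q * t)⁻¹ ∈ E) : IsBezout E :=
  isBezout_subring fun t => by
    obtain ⟨p, hp, q, hq, h0, h1, h2⟩ := hE t
    exact ⟨p, hp, q, hq, _, h1, mul_inv_cancel₀ h0, h2⟩

theorem mem_plusM_iff {E : Subring L} {f : PowerSeries L} :
    f ∈ plusM E ↔ PowerSeries.constantCoeff f ∈ E := by
  constructor
  · rintro ⟨d, hd, g, rfl⟩
    simpa using hd
  · intro h
    obtain ⟨g, hg⟩ := PowerSeries.X_dvd_iff.2
      (show PowerSeries.constantCoeff (f - PowerSeries.C (PowerSeries.constantCoeff f)) = 0 by simp)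
    exact ⟨_, h, g, by rw [← hg]; ring⟩

/-- The generators of the fractional ideals `(1, t)` of `E` lift to the fractional ideals `(1, h)`
of `E + Z L[[Z]]` with `h ∈ L[[Z]]`, since membership depends on constant coefficients only. -/
theorem isBezout_plusM {E : Subring L}
    (hE : ∀ t : L, ∃ p ∈ E, ∃ q ∈ E, p + q * t ≠ 0 ∧ (p + q * t)⁻¹ ∈ E ∧
      t * (p + q * t)⁻¹ ∈ E) : IsBezout (plusM E) :=
  isBezout_subring fun h => by
    obtain ⟨p, hp, q, hq, h0, h1, h2⟩ := hE (PowerSeries.constantCoeff h)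
    have hu : PowerSeries.constantCoeff (PowerSeries.C p + PowerSeries.C q * h) =
        p + q * PowerSeries.constantCoeff h := by simp
    refine ⟨PowerSeries.C p, ?_, PowerSeries.C q, ?_,
      (PowerSeries.C p + PowerSeries.C q * h)⁻¹, ?_, ?_, ?_⟩
    · rwa [mem_plusM_iff, PowerSeries.constantCoeff_C]
    · rwa [mem_plusM_iff, PowerSeries.constantCoeff_C]
    · rwa [mem_plusM_iff, PowerSeries.constantCoeff_inv, hu]
    · exact PowerSeries.mul_inv_cancel _ (by rwa [hu])
    · rwa [mem_plusM_iff, map_mul, PowerSeries.constantCoeff_inv, hu]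

end Bezout

end StarExample

/-! ### The `v`-operation -/

section VOperation

theorem isPruferDomain_of_isBezout (R : Type*) [CommRing R] [IsDomain R] [IsBezout R] :
    IsPruferDomain R := by
  intro I hI h0
  obtain ⟨a, rfl⟩ := (IsBezout.isPrincipal_of_FG I hI).principal
  have ha : a ≠ 0 := by rintro rfl; simp at h0
  exact IsUnit.of_mul_eq_one _
    (FractionalIdeal.coe_ideal_span_singleton_mul_inv (FractionRing R) ha)

theorem isIntegrallyClosed_of_isBezout (R : Type*) [CommRing R] [IsDomain R] [IsBezout R] :
    IsIntegrallyClosed R :=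
  inferInstance

variable {R K : Type*} [CommRing R] [IsDomain R] [Field K] [Algebra R K] [IsFractionRing R K]

theorem inv_ne_zero_fractionalIdeal {E : FractionalIdeal R⁰ K} (hE : E ≠ 0) : E⁻¹ ≠ 0 := by
  intro h
  have := FractionalIdeal.bot_lt_mul_inv (K := K) (I := E) hE
  rw [h, mul_zero] at this
  exact lt_irrefl _ this

theorem le_vOperation {E : FractionalIdeal R⁰ K} (hE : E ≠ 0) : E ≤ vOperation R K E := by
  intro z hz
  refine (FractionalIdeal.mem_inv_iff (inv_ne_zero_fractionalIdeal hE)).2 fun w hw => ?_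
  rw [mul_comm]
  exact (FractionalIdeal.mem_inv_iff hE).1 hw z hz

theorem vOperation_mono {E F : FractionalIdeal R⁰ K} (hE : E ≠ 0) (hF : F ≠ 0) (h : E ≤ F) :
    vOperation R K E ≤ vOperation R K F :=
  FractionalIdeal.inv_anti_mono (inv_ne_zero_fractionalIdeal hF) (inv_ne_zero_fractionalIdeal hE)
    (FractionalIdeal.inv_anti_mono hE hF h)

theorem inv_spanSingleton_mul {a : K} (ha : a ≠ 0) (E : FractionalIdeal R⁰ K) :
    (FractionalIdeal.spanSingleton R⁰ a * E)⁻¹ = FractionalIdeal.spanSingleton R⁰ a⁻¹ * E⁻¹ := by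
  rcases eq_or_ne E 0 with rfl | hE
  · simp [FractionalIdeal.inv_zero']
  have h0 : FractionalIdeal.spanSingleton R⁰ a * E ≠ 0 := by
    intro h
    refine hE ?_
    rw [← one_mul E, ← FractionalIdeal.spanSingleton_inv_mul K ha, mul_assoc, h, mul_zero]
  ext z
  rw [FractionalIdeal.mem_inv_iff h0, FractionalIdeal.mem_singleton_mul]
  constructor
  · intro h
    refine ⟨a * z, (FractionalIdeal.mem_inv_iff hE).2 fun w hw => ?_, by field_simp⟩
    have := h (a * w) (FractionalIdeal.mem_singleton_mul.2 ⟨w, hw, rfl⟩)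
    rwa [mul_left_comm, ← mul_assoc] at this
  · rintro ⟨w, hw, rfl⟩ v hv
    obtain ⟨v, hv', rfl⟩ := FractionalIdeal.mem_singleton_mul.1 hv
    rw [mul_mul_mul_comm, inv_mul_cancel₀ ha, one_mul]
    exact (FractionalIdeal.mem_inv_iff hE).1 hw v hv'

theorem vOperation_eq_of_isUnit {E : FractionalIdeal R⁰ K} (hE : IsUnit E) :
    vOperation R K E = E := by
  have h := (FractionalIdeal.mul_inv_cancel_iff_isUnit K).2 hE
  exact (FractionalIdeal.right_inverse_eq K _ _ (by rwa [mul_comm])).symm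

theorem isStarOperation_vOperation : IsStarOperation (vOperation R K) where
  map_one := vOperation_eq_of_isUnit isUnit_one
  map_smul a E ha _ := by
    rw [vOperation, inv_spanSingleton_mul ha, inv_spanSingleton_mul (inv_ne_zero ha), inv_inv,
      vOperation]
  le_map _ := le_vOperation
  mono _ _ := vOperation_mono
  idem E hE := by
    have hE' := inv_ne_zero_fractionalIdeal hE
    -- `E⁻¹ = ((E⁻¹)⁻¹)⁻¹`, as inversion reverses the inclusion of `E` in its closure.
    refine congrArg (·⁻¹) (le_antisymm ?_ (le_vOperation hE'))
    exact FractionalIdeal.inv_anti_mono hE (inv_ne_zero_fractionalIdeal hE') (le_vOperation hE)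

theorem inf_ne_zero_fractionalIdeal {E F : FractionalIdeal R⁰ K} (hE : E ≠ 0) (hF : F ≠ 0) :
    E ⊓ F ≠ 0 := by
  obtain ⟨a, ha, haE⟩ := FractionalIdeal.exists_ne_zero_mem_isInteger hE
  obtain ⟨b, hb, hbF⟩ := FractionalIdeal.exists_ne_zero_mem_isInteger hF
  intro h
  have hab : algebraMap R K (a * b) ∈ E ⊓ F := by
    refine ⟨?_, ?_⟩
    · have := (E : Submodule R K).smul_mem b haE
      rwa [Algebra.smul_def, ← map_mul, mul_comm] at this
    · have := (F : Submodule R K).smul_mem a hbF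
      rwa [Algebra.smul_def, ← map_mul] at this
  rw [h, FractionalIdeal.mem_zero_iff, IsFractionRing.to_map_eq_zero_iff] at hab
  exact mul_ne_zero ha hb hab

/-- If all nonzero finitely generated fractional ideals are divisorial, then `v` is finite-stable:
for such `E`, `F` one has `E_v ∩ F_v = E ∩ F ⊆ (E ∩ F)_v`, and the other inclusion is
monotonicity. -/
theorem isFiniteStable_vOperation
    (h : ∀ E : FractionalIdeal R⁰ K, E ≠ 0 → (E : Submodule R K).FG → vOperation R K E = E) :
    IsFiniteStable (vOperation R K) := by
  intro E F hE hF hE' hF'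
  have h0 := inf_ne_zero_fractionalIdeal hE hF
  refine le_antisymm
    (le_inf (vOperation_mono h0 hE inf_le_left) (vOperation_mono h0 hF inf_le_right)) ?_
  rw [h E hE hE', h F hF hF']
  exact le_vOperation h0

theorem isFiniteStable_vOperation_of_isBezout [IsBezout R] : IsFiniteStable (vOperation R K) := by
  refine isFiniteStable_vOperation fun E hE hfg => vOperation_eq_of_isUnit ?_
  have e := E.equivNum (nonZeroDivisors.coe_ne_zero E.den)
  have hnum : E.num.FG := by
    have := Module.Finite.iff_fg.2 hfg
    exact Module.Finite.iff_fg.1 (Module.Finite.equiv e)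
  have : (E : Submodule R K).IsPrincipal :=
    Module.isPrincipal_submodule_iff.1 <| e.isPrincipal_iff.2 <|
      Module.isPrincipal_submodule_iff.2 (IsBezout.isPrincipal_of_FG E.num hnum)
  exact IsUnit.of_mul_eq_one _ (FractionalIdeal.invertible_of_principal K E hE)

end VOperation

namespace StarExample

/-! ### Fractional ideals of `E + Z L[[Z]]` -/

section PlusMIdeals

variable {L : Type*} [Field L] {E E' : Subring L}

theorem algebraMap_mem_one_iff {f : PowerSeries L} :
    algebraMap (PowerSeries L) (LaurentSeries L) f ∈
      (1 : FractionalIdeal (plusM E)⁰ (LaurentSeries L)) ↔ f ∈ plusM E := by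
  rw [FractionalIdeal.mem_one_iff]
  constructor
  · rintro ⟨r, hr⟩
    rw [← IsFractionRing.injective (PowerSeries L) (LaurentSeries L) hr]
    exact r.2
  · exact fun h => ⟨⟨f, h⟩, rfl⟩

theorem mem_idealM_iff {z : LaurentSeries L} :
    z ∈ ((idealM E : Ideal (plusM E)) : FractionalIdeal (plusM E)⁰ (LaurentSeries L)) ↔
      ∃ g : PowerSeries L,
        z = algebraMap (PowerSeries L) (LaurentSeries L) (PowerSeries.X * g) := by
  rw [FractionalIdeal.mem_coeIdeal]
  constructor
  · rintro ⟨r, hr, rfl⟩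
    obtain ⟨g, hg⟩ := Ideal.mem_span_singleton.1 (Ideal.mem_comap.1 hr)
    exact ⟨g, congrArg (algebraMap (PowerSeries L) (LaurentSeries L)) hg⟩
  · rintro ⟨g, rfl⟩
    exact ⟨⟨_, X_mul_mem_plusM E g⟩, Ideal.mem_span_singleton.2 ⟨g, rfl⟩, rfl⟩

theorem mem_idealZ_iff (h : E ≤ E') {z : LaurentSeries L} :
    z ∈ ((idealZ h : Ideal (plusM E)) : FractionalIdeal (plusM E)⁰ (LaurentSeries L)) ↔
      ∃ f ∈ plusM E',
        z = algebraMap (PowerSeries L) (LaurentSeries L) (PowerSeries.X * f) := by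
  rw [FractionalIdeal.mem_coeIdeal]
  constructor
  · rintro ⟨r, ⟨f, hf, hr⟩, rfl⟩
    exact ⟨f, hf, congrArg (algebraMap (PowerSeries L) (LaurentSeries L)) hr⟩
  · rintro ⟨f, hf, rfl⟩
    exact ⟨⟨_, X_mul_mem_plusM E f⟩, ⟨f, hf, rfl⟩, rfl⟩

theorem mem_span_elemZ_iff {z : LaurentSeries L} :
    z ∈ ((Ideal.span {elemZ E} : Ideal (plusM E)) :
      FractionalIdeal (plusM E)⁰ (LaurentSeries L)) ↔
      ∃ f ∈ plusM E,
        z = algebraMap (PowerSeries L) (LaurentSeries L) (PowerSeries.X * f) := by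
  rw [FractionalIdeal.mem_coeIdeal]
  constructor
  · rintro ⟨r, hr, rfl⟩
    obtain ⟨f, rfl⟩ := Ideal.mem_span_singleton.1 hr
    exact ⟨f, f.2, rfl⟩
  · rintro ⟨f, hf, rfl⟩
    exact ⟨⟨_, X_mul_mem_plusM E f⟩, Ideal.mem_span_singleton.2 ⟨⟨f, hf⟩, Subtype.ext rfl⟩, rfl⟩

theorem idealZ_ne_zero (h : E ≤ E') :
    ((idealZ h : Ideal (plusM E)) : FractionalIdeal (plusM E)⁰ (LaurentSeries L)) ≠ 0 := by
  intro h0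
  have := (mem_idealZ_iff h).2 ⟨1, one_mem _, rfl⟩
  rw [h0, FractionalIdeal.mem_zero_iff, IsFractionRing.to_map_eq_zero_iff, mul_one] at this
  exact PowerSeries.X_ne_zero this

/-- A Laurent series `z` with `z E' ⊆ E + Z L[[Z]]` lies in `Z L[[Z]]` if `(E : E') = 0`. -/
theorem exists_eq_X_mul_of_forall_mul_mem_one (hE : ∀ a : L, (∀ b ∈ E', a * b ∈ E) → a = 0)
    {z : LaurentSeries L}
    (hz : ∀ b ∈ E', z * algebraMap (PowerSeries L) (LaurentSeries L) (PowerSeries.C b) ∈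
      (1 : FractionalIdeal (plusM E)⁰ (LaurentSeries L))) :
    ∃ g : PowerSeries L,
      z = algebraMap (PowerSeries L) (LaurentSeries L) (PowerSeries.X * g) := by
  have h1 := hz 1 (one_mem _)
  rw [map_one, map_one, mul_one, FractionalIdeal.mem_one_iff] at h1
  obtain ⟨w, rfl⟩ := h1
  have hw : PowerSeries.constantCoeff (w : PowerSeries L) = 0 := by
    refine hE _ fun b hb => ?_
    have : algebraMap (PowerSeries L) (LaurentSeries L) (w * PowerSeries.C b) ∈
        (1 : FractionalIdeal (plusM E)⁰ (LaurentSeries L)) := by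
      rw [map_mul]
      exact hz b hb
    rwa [algebraMap_mem_one_iff, mem_plusM_iff, map_mul, PowerSeries.constantCoeff_C] at this
  obtain ⟨g, hg⟩ := PowerSeries.X_dvd_iff.2 hw
  exact ⟨g, congrArg (algebraMap (PowerSeries L) (LaurentSeries L)) hg⟩

theorem mem_inv_idealZ_iff (h : E ≤ E') (hE : ∀ a : L, (∀ b ∈ E', a * b ∈ E) → a = 0)
    {z : LaurentSeries L} :
    z ∈ ((idealZ h : Ideal (plusM E)) : FractionalIdeal (plusM E)⁰ (LaurentSeries L))⁻¹ ↔
      z ∈ Set.range (algebraMap (PowerSeries L) (LaurentSeries L)) := by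
  rw [FractionalIdeal.mem_inv_iff (idealZ_ne_zero h)]
  constructor
  · intro hz
    have hX : algebraMap (PowerSeries L) (LaurentSeries L) PowerSeries.X ≠ 0 := by
      rw [Ne, IsFractionRing.to_map_eq_zero_iff]
      exact PowerSeries.X_ne_zero
    obtain ⟨g, hg⟩ := exists_eq_X_mul_of_forall_mul_mem_one hE
      (z := z * algebraMap (PowerSeries L) (LaurentSeries L) PowerSeries.X) fun b hb => by
        rw [mul_assoc, ← map_mul]
        refine hz _ ((mem_idealZ_iff h).2 ⟨_, ?_, rfl⟩)
        rwa [mem_plusM_iff, PowerSeries.constantCoeff_C]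
    rw [map_mul, mul_comm] at hg
    exact ⟨g, (mul_left_cancel₀ hX hg).symm⟩
  · rintro ⟨g, rfl⟩ _ hw
    obtain ⟨f, -, rfl⟩ := (mem_idealZ_iff h).1 hw
    rw [← map_mul, algebraMap_mem_one_iff, mul_left_comm]
    exact X_mul_mem_plusM E _

theorem vOperation_idealZ (h : E ≤ E') (hE : ∀ a : L, (∀ b ∈ E', a * b ∈ E) → a = 0) :
    vOperation (plusM E) (LaurentSeries L) (idealZ h : Ideal (plusM E)) =
      (idealM E : Ideal (plusM E)) := by
  ext z
  rw [vOperation, FractionalIdeal.mem_inv_iff (inv_ne_zero_fractionalIdeal (idealZ_ne_zero h)),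
    mem_idealM_iff]
  constructor
  · exact fun hz => exists_eq_X_mul_of_forall_mul_mem_one hE fun b _ =>
      hz _ ((mem_inv_idealZ_iff h hE).2 ⟨_, rfl⟩)
  · rintro ⟨g, rfl⟩ _ hw
    obtain ⟨f, rfl⟩ := (mem_inv_idealZ_iff h hE).1 hw
    rw [← map_mul, algebraMap_mem_one_iff, mul_assoc]
    exact X_mul_mem_plusM E _

theorem vOperation_span_elemZ :
    vOperation (plusM E) (LaurentSeries L) (Ideal.span {elemZ E} : Ideal (plusM E)) =
      (Ideal.span {elemZ E} : Ideal (plusM E)) := by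
  refine vOperation_eq_of_isUnit (IsUnit.of_mul_eq_one _
    (FractionalIdeal.coe_ideal_span_singleton_mul_inv (LaurentSeries L) fun h => ?_))
  exact PowerSeries.X_ne_zero (congrArg Subtype.val h)

theorem idealZ_inf_idealZ {E₁ E₂ : Subring L} :
    ((idealZ (inf_le_left : E₁ ⊓ E₂ ≤ E₁) : Ideal (plusM (E₁ ⊓ E₂))) :
      FractionalIdeal (plusM (E₁ ⊓ E₂))⁰ (LaurentSeries L)) ⊓
      (idealZ (inf_le_right : E₁ ⊓ E₂ ≤ E₂) : Ideal (plusM (E₁ ⊓ E₂))) =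
      (Ideal.span {elemZ (E₁ ⊓ E₂)} : Ideal (plusM (E₁ ⊓ E₂))) := by
  ext z
  rw [mem_span_elemZ_iff]
  constructor
  · rintro ⟨h₁, h₂⟩
    obtain ⟨f, hf, rfl⟩ := (mem_idealZ_iff _).1 h₁
    obtain ⟨g, hg, hfg⟩ := (mem_idealZ_iff _).1 h₂
    obtain rfl := mul_left_cancel₀ PowerSeries.X_ne_zero
      (IsFractionRing.injective (PowerSeries L) (LaurentSeries L) hfg)
    exact ⟨f, mem_plusM_iff.2 ⟨mem_plusM_iff.1 hf, mem_plusM_iff.1 hg⟩, rfl⟩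
  · rintro ⟨f, hf, rfl⟩
    exact ⟨(mem_idealZ_iff _).2 ⟨f, plusM_mono inf_le_left hf, rfl⟩,
      (mem_idealZ_iff _).2 ⟨f, plusM_mono inf_le_right hf, rfl⟩⟩

theorem span_elemZ_lt_idealM {c : L} (hc : c ∉ E) :
    ((Ideal.span {elemZ E} : Ideal (plusM E)) : FractionalIdeal (plusM E)⁰ (LaurentSeries L)) <
      (idealM E : Ideal (plusM E)) := by
  refine lt_of_le_not_ge (fun z hz => ?_) fun h => hc ?_
  · obtain ⟨f, -, rfl⟩ := mem_span_elemZ_iff.1 hz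
    exact mem_idealM_iff.2 ⟨f, rfl⟩
  · obtain ⟨f, hf, hfc⟩ := mem_span_elemZ_iff.1
      (h (mem_idealM_iff.2 ⟨PowerSeries.C c, rfl⟩))
    obtain rfl := mul_left_cancel₀ PowerSeries.X_ne_zero
      (IsFractionRing.injective (PowerSeries L) (LaurentSeries L) hfc)
    simpa [mem_plusM_iff] using hf

end PlusMIdeals

/-! ### The rings `D₁`, `D₂` and `D` -/

section Rings

variable (k : Type*) [Field k]

theorem mem_or_inv_mem_D₁ (z : kXY k) : z ∈ D₁ k ∨ z⁻¹ ∈ D₁ k :=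
  mem_or_inv_mem_locAt (transcendental_y k) (exists_eq_aeval_y_div k) z

theorem mem_or_inv_mem_D₂ (z : kXY k) : z ∈ D₂ k ∨ z⁻¹ ∈ D₂ k :=
  mem_or_inv_mem_locAt (transcendental_x k) (exists_eq_aeval_x_div k) z

theorem inv_x_mem_D₁ : (x k)⁻¹ ∈ D₁ k :=
  mem_locAt_of_mem (inv_mem (IntermediateField.mem_adjoin_simple_self k (x k)))

theorem inv_y_mem_D₂ : (y k)⁻¹ ∈ D₂ k :=
  mem_locAt_of_mem (inv_mem (IntermediateField.mem_adjoin_simple_self k (y k)))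

theorem x_mem_D : x k ∈ D k :=
  ⟨mem_locAt_of_mem (IntermediateField.mem_adjoin_simple_self k (x k)), self_mem_locAt _ _⟩

theorem y_mem_D : y k ∈ D k :=
  ⟨self_mem_locAt _ _, mem_locAt_of_mem (IntermediateField.mem_adjoin_simple_self k (y k))⟩

theorem eq_top_of_D₁_le_of_D₂_le {T : Subring (kXY k)} (h₁ : D₁ k ≤ T) (h₂ : D₂ k ≤ T) : T = ⊤ :=
  eq_top_of_locAt_le (transcendental_y k) (exists_eq_aeval_y_div k) h₁ (h₂ (inv_y_mem_D₂ k))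

theorem eq_zero_of_mul_D₁_subset {a : kXY k} (ha : ∀ b ∈ D₁ k, a * b ∈ D k) : a = 0 :=
  eq_zero_of_forall_mul_inv_pow_mem_locAt (transcendental_x k) (exists_eq_aeval_x_div k)
    fun n => (ha _ (pow_mem (inv_x_mem_D₁ k) n)).2

theorem eq_zero_of_mul_D₂_subset {a : kXY k} (ha : ∀ b ∈ D₂ k, a * b ∈ D k) : a = 0 :=
  eq_zero_of_forall_mul_inv_pow_mem_locAt (transcendental_y k) (exists_eq_aeval_y_div k)
    fun n => (ha _ (pow_mem (inv_y_mem_D₂ k) n)).1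

theorem notMem_Q₁_iff {w : D k} : w ∉ Q₁ k ↔ (w : kXY k) ≠ 0 ∧ (w : kXY k)⁻¹ ∈ D₁ k :=
  notMem_locIdeal_iff (transcendental_y k) (exists_eq_aeval_y_div k)
    (w := Subring.inclusion (D_le_D₁ k) w)

theorem notMem_Q₂_iff {w : D k} : w ∉ Q₂ k ↔ (w : kXY k) ≠ 0 ∧ (w : kXY k)⁻¹ ∈ D₂ k :=
  notMem_locIdeal_iff (transcendental_x k) (exists_eq_aeval_x_div k)
    (w := Subring.inclusion (D_le_D₂ k) w)

theorem isUnit_D_iff {w : D k} : IsUnit w ↔ w ∉ Q₁ k ∧ w ∉ Q₂ k := by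
  rw [isUnit_subring_iff, notMem_Q₁_iff, notMem_Q₂_iff]
  exact ⟨fun h => ⟨⟨h.1, h.2.1⟩, h.1, h.2.2⟩, fun h => ⟨h.1.1, h.1.2, h.2.2⟩⟩

/-- If the non-units are the elements of two incomparable ideals, these are the maximal ideals. -/
theorem setOf_isMaximal_eq_pair {S : Type*} [CommRing S] {I J : Ideal S}
    (h : ∀ w : S, IsUnit w ↔ w ∉ I ∧ w ∉ J) (hIJ : ¬ I ≤ J) (hJI : ¬ J ≤ I) :
    {P : Ideal S | P.IsMaximal} = {I, J} := by
  have hI : I ≠ ⊤ := fun e => ((h 1).1 isUnit_one).1 (e ▸ Submodule.mem_top)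
  have hJ : J ≠ ⊤ := fun e => ((h 1).1 isUnit_one).2 (e ▸ Submodule.mem_top)
  have key : ∀ P : Ideal S, P.IsMaximal → P = I ∨ P = J := by
    intro P hP
    have hsub : (P : Set S) ⊆ I ∪ J := by
      intro w hw
      by_contra hw'
      rw [Set.mem_union, not_or] at hw'
      exact hP.ne_top (P.eq_top_of_isUnit_mem hw ((h w).2 hw'))
    exact (Ideal.subset_union.1 hsub).imp (hP.eq_of_le hI) (hP.eq_of_le hJ)
  ext P
  refine ⟨key P, ?_⟩
  rintro (rfl | rfl)
  · obtain ⟨P', hP', hle⟩ := Ideal.exists_le_maximal _ hI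
    rcases key P' hP' with rfl | rfl
    exacts [hP', absurd hle hIJ]
  · obtain ⟨P', hP', hle⟩ := Ideal.exists_le_maximal _ hJ
    rcases key P' hP' with rfl | rfl
    exacts [absurd hle hJI, hP']

theorem not_Q₁_le_Q₂ : ¬ Q₁ k ≤ Q₂ k := fun h =>
  (notMem_Q₂_iff k (w := ⟨y k, y_mem_D k⟩)).2
    ⟨ne_zero_of_transcendental (transcendental_y k), inv_y_mem_D₂ k⟩
    (h (Ideal.mem_span_singleton_self _))

theorem not_Q₂_le_Q₁ : ¬ Q₂ k ≤ Q₁ k := fun h =>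
  (notMem_Q₁_iff k (w := ⟨x k, x_mem_D k⟩)).2
    ⟨ne_zero_of_transcendental (transcendental_x k), inv_x_mem_D₁ k⟩
    (h (Ideal.mem_span_singleton_self _))

instance isBezout_D : IsBezout (D k) :=
  isBezout_of_exists_generator (exists_generator_inf (mem_or_inv_mem_D₁ k) (mem_or_inv_mem_D₂ k))

instance isBezout_R : IsBezout (R k) :=
  isBezout_plusM (exists_generator_inf (mem_or_inv_mem_D₁ k) (mem_or_inv_mem_D₂ k))

theorem vOperation_A : vOperation (R k) (K k) (A k) = M k :=
  vOperation_idealZ (D_le_D₁ k) fun _ => eq_zero_of_mul_D₁_subset k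

theorem vOperation_B : vOperation (R k) (K k) (B k) = M k :=
  vOperation_idealZ (D_le_D₂ k) fun _ => eq_zero_of_mul_D₂_subset k

theorem A_inf_B : A k ⊓ B k = ZR k := idealZ_inf_idealZ

theorem ZR_lt_M : ZR k < M k :=
  span_elemZ_lt_idealM (c := (x k)⁻¹) fun h => inv_notMem_locAt (transcendental_x k) h.2

theorem vOperation_A_inf_B : vOperation (R k) (K k) (A k ⊓ B k) = ZR k := by
  rw [A_inf_B]
  exact vOperation_span_elemZ

theorem not_isStable_vOperation : ¬ IsStable (vOperation (R k) (K k)) := by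
  intro h
  have := h (A k) (B k) (idealZ_ne_zero _) (idealZ_ne_zero _)
  rw [vOperation_A_inf_B, vOperation_A, vOperation_B, inf_idem] at this
  exact (ZR_lt_M k).ne this

end Rings

end StarExample

theorem mainTheorem4 (k : Type u) [Field k] :
    -- `D₁` and `D₂` are independent valuation domains of `k(X, Y)` with maximal ideals `M₁`, `M₂`
    (IsFractionRing (StarExample.D₁ k) (StarExample.kXY k) ∧ ValuationRing (StarExample.D₁ k) ∧
      {P : Ideal (StarExample.D₁ k) | P.IsMaximal} = {StarExample.M₁ k}) ∧
    (IsFractionRing (StarExample.D₂ k) (StarExample.kXY k) ∧ ValuationRing (StarExample.D₂ k) ∧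
      {P : Ideal (StarExample.D₂ k) | P.IsMaximal} = {StarExample.M₂ k}) ∧
    (∀ T : Subring (StarExample.kXY k), StarExample.D₁ k ≤ T → StarExample.D₂ k ≤ T → T = ⊤) ∧
    -- `D` is a Prüfer domain with exactly two maximal ideals, and `(D : D₁) = (D : D₂) = 0`
    IsPruferDomain (StarExample.D k) ∧
    {P : Ideal (StarExample.D k) | P.IsMaximal} = {StarExample.Q₁ k, StarExample.Q₂ k} ∧
    StarExample.Q₁ k ≠ StarExample.Q₂ k ∧
    (∀ a : StarExample.kXY k, (∀ b ∈ StarExample.D₁ k, a * b ∈ StarExample.D k) → a = 0) ∧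
    (∀ a : StarExample.kXY k, (∀ b ∈ StarExample.D₂ k, a * b ∈ StarExample.D k) → a = 0) ∧
    -- `R` is a Prüfer domain whose `v`-operation is finite-stable but not stable
    IsPruferDomain (StarExample.R k) ∧
    IsFiniteStable (vOperation (StarExample.R k) (StarExample.K k)) ∧
    ¬ IsStable (vOperation (StarExample.R k) (StarExample.K k)) ∧
    -- the failure of stability is witnessed by `A` and `B`
    (((StarExample.A k)⁻¹ : FractionalIdeal (StarExample.R k)⁰ (StarExample.K k)) :
      Set (StarExample.K k)) = StarExample.V k ∧
    (((StarExample.B k)⁻¹ : FractionalIdeal (StarExample.R k)⁰ (StarExample.K k)) :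
      Set (StarExample.K k)) = StarExample.V k ∧
    vOperation (StarExample.R k) (StarExample.K k) (StarExample.A k) = StarExample.M k ∧
    vOperation (StarExample.R k) (StarExample.K k) (StarExample.B k) = StarExample.M k ∧
    StarExample.A k ⊓ StarExample.B k = StarExample.ZR k ∧
    vOperation (StarExample.R k) (StarExample.K k) (StarExample.A k ⊓ StarExample.B k) =
      StarExample.ZR k ∧
    StarExample.ZR k < StarExample.M k ∧
    -- first question: is every finite-stable star operation stable?
    (¬ ∀ (R K : Type u) [CommRing R] [IsDomain R] [Field K] [Algebra R K] [IsFractionRing R K]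
      (s : FractionalIdeal R⁰ K → FractionalIdeal R⁰ K),
      IsStarOperation s → IsFiniteStable s → IsStable s) ∧
    -- second question: if `R` is integrally closed and `v` is finite-stable, is `v` stable?
    (¬ ∀ (R K : Type u) [CommRing R] [IsDomain R] [Field K] [Algebra R K] [IsFractionRing R K],
      IsIntegrallyClosed R → IsFiniteStable (vOperation R K) → IsStable (vOperation R K)) ∧
    -- third question: is `v` stable on every Prüfer domain?
    (¬ ∀ (R K : Type u) [CommRing R] [IsDomain R] [Field K] [Algebra R K] [IsFractionRing R K],
      IsPruferDomain R → IsStable (vOperation R K)) := by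
  open StarExample in
  exact ⟨⟨isFractionRing_of_mem_or_inv_mem (mem_or_inv_mem_D₁ k),
      valuationRing_of_mem_or_inv_mem (mem_or_inv_mem_D₁ k),
      setOf_isMaximal_locAt (transcendental_y k) (exists_eq_aeval_y_div k)⟩,
    ⟨isFractionRing_of_mem_or_inv_mem (mem_or_inv_mem_D₂ k),
      valuationRing_of_mem_or_inv_mem (mem_or_inv_mem_D₂ k),
      setOf_isMaximal_locAt (transcendental_x k) (exists_eq_aeval_x_div k)⟩,
    fun _ => eq_top_of_D₁_le_of_D₂_le k, isPruferDomain_of_isBezout _,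
    setOf_isMaximal_eq_pair (fun _ => isUnit_D_iff k) (not_Q₁_le_Q₂ k) (not_Q₂_le_Q₁ k),
    fun h => not_Q₁_le_Q₂ k h.le, fun _ => eq_zero_of_mul_D₁_subset k,
    fun _ => eq_zero_of_mul_D₂_subset k, isPruferDomain_of_isBezout _,
    isFiniteStable_vOperation_of_isBezout, not_isStable_vOperation k,
    Set.ext fun _ => mem_inv_idealZ_iff (D_le_D₁ k) fun _ => eq_zero_of_mul_D₁_subset k,
    Set.ext fun _ => mem_inv_idealZ_iff (D_le_D₂ k) fun _ => eq_zero_of_mul_D₂_subset k,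
    vOperation_A k, vOperation_B k, A_inf_B k, vOperation_A_inf_B k, ZR_lt_M k,
    fun h => not_isStable_vOperation k
      (h _ _ _ isStarOperation_vOperation isFiniteStable_vOperation_of_isBezout),
    fun h => not_isStable_vOperation k
      (h _ _ (isIntegrallyClosed_of_isBezout _) isFiniteStable_vOperation_of_isBezout),
    fun h => not_isStable_vOperation k (h _ _ (isPruferDomain_of_isBezout _))⟩
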